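/- A Motzkin path of length $n$ is a lattice path from $(0,0)$ to $(n,0)$ with up steps $U=(1,1)$, horizontal steps $H=(1,0)$ and down steps $D=(1,-1)$ that never goes below the $x$-axis. A Riordan path is a Motzkin path without horizontal steps on the $x$-axis. The height of a step is the $y$-coordinate of its starting point. The area of a path is the area of the region between the path and the $x$-axis. This region is divided into unit squares and triangles with unit bottom side, and the cell with bottom side from $(i,j)$ to $(i+1,j)$ has the label $i+j$ (triangles containing an up step are not labelled). Let $P$ be a Motzkin path with $k$ up steps. Put $P_k=P$. For $i=k,k-1,\dots,1$ let $A\to B$ be the last up step and $E\to F$ the last down step of $P_i$; let $h_i$ be the label of the cell containing the step $E\to F$, and $t_i$ the label of the cell containing the step that starts at $B$ (the square below that step if it is horizontal). Let $P_{i-1}$ be the path that follows $P_i$ up to $A$, then takes a horizontal step, then follows the segment of $P_i$ from $B$ to $E$ lowered by $1$, and then continues along the $x$-axis to $(n,0)$. Define the permutation $\phi(P)\in S_n$ by $$\phi(P)=(1\,2\,\cdots\,n)\,\sigma_1\sigma_2\cdots\sigma_k,\qquad \sigma_i=s_{h_i}s_{h_i-1}\cdots s_{t_i},$$ where $(1\,2\,\cdots\,n)$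 is the identity permutation as a word and $s_j$ acts on the right by interchanging the entries in positions $j$ and $j+1$. Let $D_n(321,3\bar142)$ be the set of derangements $\pi=\pi_1\cdots\pi_n$ of $\{1,\dots,n\}$ such that there are no $i<j<l$ with $\pi_i>\pi_j>\pi_l$, and such that for all $i<j<l$ with $\pi_j>\pi_i>\pi_l$ there is $m$ with $i<m<j$ and $\pi_m<\pi_l$. **Statement.** Let $P$ be a Riordan path of length $n$. Then $\phi(P)\in D_n(321,3\bar142)$, and the area of $P$ minus the sum of the heights of the up steps of $P$ is equal to the inversion number of $\phi(P)$, that is, to the number of pairs $i<j$ with $\phi(P)_i>\phi(P)_j$. -/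

import Mathlib

namespace Riordan

/-- The steps of a Motzkin path: up `(1,1)`, horizontal `(1,0)`, down `(1,-1)`. -/
inductive Step where
  | U : Step
  | H : Step
  | D : Step
  deriving DecidableEq

/-- The change of the `y`-coordinate along a step. -/
def Step.rise : Step → ℤ
  | .U => 1
  | .H => 0
  | .D => -1

/-- The `y`-coordinate of the point with `x`-coordinate `i` on the lattice path from `(0,0)` with
step sequence `P`. For `i < P.length` this is the height of the step number `i` (counted from `0`),
that is, the `y`-coordinate of the starting point of that step. -/
def height (P : List Step) (i : ℕ) : ℤ := ((P.take i).map Step.rise).sum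

/-- `P` is the step sequence of a Motzkin path of length `n`: a lattice path from `(0,0)` to
`(n,0)` that never goes below the `x`-axis. -/
structure IsMotzkinPath (n : ℕ) (P : List Step) : Prop where
  length_eq : P.length = n
  nonneg : ∀ i ≤ n, 0 ≤ height P i
  height_end : height P n = 0

/-- A Riordan path of length `n`: a Motzkin path of length `n` without horizontal steps on the
`x`-axis. -/
structure IsRiordanPath (n : ℕ) (P : List Step) : Prop extends IsMotzkinPath n P where
  no_flat : ∀ i < n, P[i]? = some Step.H → height P i ≠ 0

/-! ### Area and heights of the up steps -/

/-- The path as the graph of a piecewise linear function on `[0, P.length]`, which interpolates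
linearly between the consecutive lattice points `(i, height P i)`. -/
noncomputable def graph (P : List Step) (x : ℝ) : ℝ :=
  (height P ⌊x⌋₊ : ℝ) +
    (x - (⌊x⌋₊ : ℝ)) * ((height P (⌊x⌋₊ + 1) : ℝ) - (height P ⌊x⌋₊ : ℝ))

/-- The region surrounded by the path and the `x`-axis. -/
def region (P : List Step) : Set (ℝ × ℝ) :=
  {p | 0 ≤ p.1 ∧ p.1 ≤ (P.length : ℝ) ∧ 0 ≤ p.2 ∧ p.2 ≤ graph P p.1}

/-- The area of a path: the area of the region surrounded by the path and the `x`-axis. -/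
noncomputable def area (P : List Step) : ℝ :=
  (MeasureTheory.volume (region P)).toReal

/-- The sum of the heights of the up steps. -/
def upHeightSum (P : List Step) : ℤ :=
  ∑ i ∈ (Finset.range P.length).filter (fun i => P[i]? = some Step.U), height P i

/-! ### The strip decomposition and the map `φ` -/

/-- The index of the last step of kind `s` (and `0` if there is none). -/
def lastIndex (s : Step) (P : List Step) : ℕ :=
  Nat.findGreatest (fun i => P[i]? = some s) P.length

/-- The `(x+y)`-label of the cell whose bottom side joins `(i, j)` and `(i + 1, j)`. -/
def cellLabel (i : ℕ) (j : ℤ) : ℕ := ((i : ℤ) + j).toNat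

/-- The label of the cell of the region that contains the step number `i`, for a horizontal or down
step `i` of positive height `y`: that cell is the square below the horizontal step, respectively the
triangle that contains the down step, and in both cases its bottom side joins `(i, y - 1)` and
`(i + 1, y - 1)`. -/
def stepLabel (P : List Step) (i : ℕ) : ℕ := cellLabel i (height P i - 1)

/-- The head `h` of the strip of a path `P` with at least one up step: the label of the cell that
contains the last down step `E → F`. -/
def stripHead (P : List Step) : ℕ := stepLabel P (lastIndex Step.D P)

/-- The tail `t` of the strip of a path `P` with at least one up step: the label of the cell that
contains the step starting from `B`, where `A → B` is the last up step. -/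
def stripTail (P : List Step) : ℕ := stepLabel P (lastIndex Step.U P + 1)

/-- The path that remains when the strip is removed. With `A → B` the last up step and `E → F` the
last down step, it follows `P` up to `A`, takes the horizontal step from `A` to `B'`, then
follows the segment of `P` from `B` to `E`, moved down by one, from `B'` to `E'`, and finally
continues on the `x`-axis to the end. -/
def removeStrip (P : List Step) : List Step :=
  let a := lastIndex Step.U P
  let e := lastIndex Step.D P
  P.take a ++ [Step.H] ++ (P.take e).drop (a + 1) ++ List.replicate (P.length - e) Step.H

/-- The parameters `(h_1, t_1), …, (h_k, t_k)` of the strip decomposition of a path `P` with `k` up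
steps. The pair `(h_k, t_k)` comes from `P` itself, and `(h_i, t_i)` from the path that is left
after `k - i` strips have been removed. -/
def stripParameters (P : List Step) : List (ℕ × ℕ) :=
  let k := P.count Step.U
  (List.range k).map fun i =>
    let Q := removeStrip^[k - (i + 1)] P
    (stripHead Q, stripTail Q)

/-- The simple transposition `s_i`, for `1 ≤ i ≤ n - 1`, which interchanges the positions `i` and
`i + 1` among the positions `1, …, n`. Position `j` is the element `j - 1` of `Fin n`. As the
product of `Equiv.Perm (Fin n)` is composition of functions, `π * s_i` is the word `π` with
the entries in the positions `i` and `i + 1` interchanged. -/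
def simpleTransposition (n i : ℕ) : Equiv.Perm (Fin n) :=
  if h : 1 ≤ i ∧ i < n then Equiv.swap ⟨i - 1, by omega⟩ ⟨i, h.2⟩ else 1

/-- The product `s_h s_{h-1} ⋯ s_t`. -/
def descendingProduct (n h t : ℕ) : Equiv.Perm (Fin n) :=
  ((List.range' t (h + 1 - t)).reverse.map (simpleTransposition n)).prod

/-- The map `φ`: the permutation `(1 2 ⋯ n) σ_1 σ_2 ⋯ σ_k`, with `σ_i = s_{h_i} s_{h_i - 1} ⋯ s_{t_i}`
for the parameters `(h_i, t_i)` of the strip decomposition of `P`. -/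
def phi (n : ℕ) (P : List Step) : Equiv.Perm (Fin n) :=
  ((stripParameters P).map fun p => descendingProduct n p.1 p.2).prod

/-! ### Permutations -/

/-- The permutation `π` avoids the pattern `321`. -/
def Avoids321 {n : ℕ} (π : Equiv.Perm (Fin n)) : Prop :=
  ∀ i j k : Fin n, i < j → j < k → ¬ (π j < π i ∧ π k < π j)

/-- The permutation `π` avoids the barred pattern `3 1̄ 4 2`: every subsequence of pattern `231`
extends to one of pattern `3142`. -/
def Avoids3142Bar {n : ℕ} (π : Equiv.Perm (Fin n)) : Prop :=
  ∀ i j k : Fin n, i < j → j < k → π k < π i → π i < π j →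
    ∃ m : Fin n, i < m ∧ m < j ∧ π m < π k

/-- `D_n(321, 3 1̄ 4 2)`: the derangements on `n` letters that avoid both patterns. -/
def avoidingDerangements (n : ℕ) : Set (Equiv.Perm (Fin n)) :=
  {π | π ∈ derangements (Fin n) ∧ Avoids321 π ∧ Avoids3142Bar π}

/-- The inversion number of a permutation. -/
def inversionNumber {n : ℕ} (π : Equiv.Perm (Fin n)) : ℕ :=
  ((Finset.univ : Finset (Fin n × Fin n)).filter
    (fun p => p.1 < p.2 ∧ π p.2 < π p.1)).card

end Riordan

namespace Riordan

/-! ### The permutations `s_h ⋯ s_t` -/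

/-! Induct on the number of up steps. Let `a` and `e` be the indices of the last up and last down
step, and put `p = a + height P a`. The last strip has head `e` and tail `p + 1`, so with positions
counted from `0` the permutation of `P` arises from that of `removeStrip P` by moving the entry at
position `e` left to position `p` and shifting the entries in between right by one
(`mul_descendingProduct_apply`).

The smaller permutation fixes every position from `e` on, and its excedances sit at positions `u +
height P u` for up steps `u < a`. A path falls by at most one per step, so `i + height P i` is
weakly increasing, and it grows by two along an up step. Hence the old excedances lie at positions
below `p - 1`. The move creates one new excedance, at `p` with value `e`, and keeps the order of the
nonexcedances. So excedances are nonadjacent and increasing, and nonexcedances are increasing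
(`IsTwoIncreasing`); this shape forces both pattern conditions.

In this shape the inversion number is the total excess over the excedances, which the move raises by
`e - p`. The area is the sum of all heights; the strip contributes `e - a` to it and `height P a` to
the up-step heights, again a difference of `e - p`. Finally, fixed points can occur only at
horizontal steps on the axis, which a Riordan path lacks. `IsPathPerm` bundles these invariants for
all Motzkin paths, because `removeStrip` leaves the class of Riordan paths. -/

theorem simpleTransposition_apply {n i : ℕ} (hi : 1 ≤ i) (hn : i < n) (x : Fin n) :
    (simpleTransposition n i x : ℕ) =
      if (x : ℕ) + 1 = i then i else if (x : ℕ) = i then i - 1 else x := by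
  rw [simpleTransposition, dif_pos ⟨hi, hn⟩, Equiv.swap_apply_def]
  simp only [Fin.ext_iff]
  split_ifs <;> (try dsimp only) <;> omega

/-- Induction peels off the rightmost factor `s_t`. The bound `t ≤ h + 1` admits the empty product
as base case. -/
theorem descendingProduct_apply {n h t : ℕ} (ht : 1 ≤ t) (hth : t ≤ h + 1) (hn : h < n)
    (x : Fin n) : (descendingProduct n h t x : ℕ) =
      if (x : ℕ) + 1 = t then h else if t ≤ x ∧ (x : ℕ) ≤ h then x - 1 else x := by
  obtain ⟨m, hm⟩ : ∃ m, h + 1 - t = m := ⟨_, rfl⟩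
  induction m generalizing t x with
  | zero =>
    obtain rfl : t = h + 1 := by omega
    simp only [descendingProduct, hm, List.range'_zero, List.reverse_nil, List.map_nil,
      List.prod_nil, Equiv.Perm.coe_one, id_eq]
    split_ifs <;> omega
  | succ m ih =>
    have hrec : descendingProduct n h t =
        descendingProduct n h (t + 1) * simpleTransposition n t := by
      simp only [descendingProduct, hm, show h + 1 - (t + 1) = m by omega, List.range'_succ,
        List.reverse_cons, List.map_append, List.prod_append, List.map_cons, List.map_nil,
        List.prod_singleton]
    rw [hrec, Equiv.Perm.mul_apply, ih (by omega) (by omega) _ (by omega),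
      simpleTransposition_apply ht (by omega)]
    split_ifs <;> omega

/-! ### Permutations whose excedances and nonexcedances increase -/

/-- A permutation that is increasing on its excedance positions, which are pairwise nonadjacent,
and on the remaining positions. -/
structure IsTwoIncreasing {n : ℕ} (f : Equiv.Perm (Fin n)) : Prop where
  exc : ∀ x y, x < y → x < f x → y < f y → (x : ℕ) + 1 < y ∧ f x < f y
  nonexc : ∀ x y, x < y → f x ≤ x → f y ≤ y → f x < f y

namespace IsTwoIncreasing

variable {n : ℕ} {f : Equiv.Perm (Fin n)}

theorem exc_of_inversion (hf : IsTwoIncreasing f) {x y : Fin n} (hxy : x < y) (h : f y < f x) :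
    x < f x := by
  by_contra! hx
  by_cases hy : y < f y
  · exact absurd (hx.trans_lt (hxy.trans hy)) h.not_gt
  · exact absurd (hf.nonexc x y hxy hx (not_lt.1 hy)) h.not_gt

theorem lt_apply_of_lt_exc (hf : IsTwoIncreasing f) {x y : Fin n} (hyx : y < x) (hx : x < f x) :
    f y < f x := by
  by_cases hy : y < f y
  · exact (hf.exc y x hyx hy hx).2
  · exact (not_lt.1 hy).trans_lt (hyx.trans hx)

theorem nonexc_of_inversion (hf : IsTwoIncreasing f) {x y : Fin n} (hxy : x < y) (h : f y < f x) :
    f y ≤ y := by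
  by_contra! hy
  exact absurd (hf.lt_apply_of_lt_exc hxy hy) h.not_gt

/-- The middle entry of a `321` would be both the right end of an inversion, hence a nonexcedance,
and the left end of one, hence an excedance. -/
theorem avoids321 (hf : IsTwoIncreasing f) : Avoids321 f := fun _ _ _ hij hjk ⟨h1, h2⟩ =>
  absurd (hf.exc_of_inversion hjk h2) (hf.nonexc_of_inversion hij h1).not_gt

theorem avoids3142Bar (hf : IsTwoIncreasing f) : Avoids3142Bar f := by
  intro i j k hij hjk hki hij'
  have hi := hf.exc_of_inversion (hij.trans hjk) hki
  have hj := hf.exc_of_inversion hjk (hki.trans hij')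
  have hk := hf.nonexc_of_inversion hjk (hki.trans hij')
  have h2 := (hf.exc i j hij hi hj).1
  -- In a `231` the first two entries are excedances and the last is not. Nonadjacency puts a
  -- nonexcedance right after `i` and before `j`; it is smaller than the later nonexcedance at `k`.
  let m : Fin n := ⟨i + 1, by omega⟩
  have him : i < m := Fin.lt_def.2 (Nat.lt_succ_self _)
  have hmj : m < j := Fin.lt_def.2 h2
  refine ⟨m, him, hmj, hf.nonexc m k (hmj.trans hjk) ?_ hk⟩
  by_contra! hm
  exact absurd (hf.exc i m him hi hm).1 (lt_irrefl _)

theorem inversionNumber_eq (hf : IsTwoIncreasing f) :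
    inversionNumber f = ∑ x, ((f x : ℕ) - x) := by
  have h1 : inversionNumber f =
      ∑ x, (Finset.univ.filter fun y => x < y ∧ f y < f x).card := by
    simp only [inversionNumber, Finset.card_filter, ← Finset.univ_product_univ,
      Finset.sum_product]
  rw [h1]
  refine Finset.sum_congr rfl fun x _ => ?_
  by_cases hx : x < f x
  -- All positions before an excedance `x` carry values below `f x`. Of the `f x` positions with
  -- smaller values, exactly `x` lie to the left, which leaves `f x - x` inversions. A nonexcedance
  -- starts none, matching the truncated subtraction.
  · have h2 : (Finset.univ.filter fun y => x < y ∧ f y < f x) =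
        (Finset.Iio (f x)).map f.symm.toEmbedding \ Finset.Iio x := by
      ext y
      simp only [Finset.mem_filter, Finset.mem_univ, true_and, Finset.mem_sdiff,
        Finset.mem_map_equiv, Equiv.symm_symm, Finset.mem_Iio, not_lt]
      refine ⟨fun h => ⟨h.2, h.1.le⟩, fun h => ⟨lt_of_le_of_ne h.2 ?_, h.1⟩⟩
      rintro rfl
      exact lt_irrefl _ h.1
    rw [h2, Finset.card_sdiff_of_subset, Finset.card_map, Fin.card_Iio, Fin.card_Iio]
    intro y hy
    simp only [Finset.mem_Iio, Finset.mem_map_equiv, Equiv.symm_symm] at hy ⊢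
    exact hf.lt_apply_of_lt_exc hy hx
  · rw [Finset.card_eq_zero.2, Nat.sub_eq_zero_of_le (Fin.le_def.1 (not_lt.1 hx))]
    exact Finset.filter_eq_empty_iff.2 fun y _ h => hx (hf.exc_of_inversion h.1 h.2)

end IsTwoIncreasing

/-! ### Moving a fixed value to the left -/

section MoveLeft

variable {n p d : ℕ} {f : Equiv.Perm (Fin n)}

theorem apply_lt_of_fixes_tail (hfix : ∀ x : Fin n, d ≤ x → f x = x) {x : Fin n}
    (hx : (x : ℕ) < d) : (f x : ℕ) < d := by
  by_contra! h
  have h2 : (f x : ℕ) = x := congrArg Fin.val (f.injective (hfix (f x) h))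
  omega

theorem mul_descendingProduct_apply (hpd : p < d) (hd : d < n)
    (hfix : ∀ x : Fin n, d ≤ x → f x = x) (x : Fin n) :
    ((x : ℕ) = p ∧ ((f * descendingProduct n d (p + 1)) x : ℕ) = d) ∨
    (∃ y : Fin n, (y : ℕ) + 1 = x ∧ p ≤ y ∧ (y : ℕ) < d ∧
      (f * descendingProduct n d (p + 1)) x = f y) ∨
    (((x : ℕ) < p ∨ d < x) ∧ (f * descendingProduct n d (p + 1)) x = f x) := by
  have h := descendingProduct_apply (t := p + 1) (by omega) (by omega) hd x
  rw [Equiv.Perm.mul_apply]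
  split_ifs at h with h1 h2
  · exact .inl ⟨by omega, by rw [hfix _ h.ge, h]⟩
  · exact .inr (.inl ⟨_, by omega, by omega, by omega, rfl⟩)
  · exact .inr (.inr ⟨by omega, congrArg f (Fin.ext h)⟩)

theorem exc_mul_descendingProduct (hpd : p < d) (hd : d < n)
    (hfix : ∀ x : Fin n, d ≤ x → f x = x)
    (hexc : ∀ x : Fin n, x < f x → (x : ℕ) + 1 < p) {x : Fin n}
    (hx : x < (f * descendingProduct n d (p + 1)) x) :
    ((x : ℕ) = p ∧ ((f * descendingProduct n d (p + 1)) x : ℕ) = d) ∨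
      ((x : ℕ) + 1 < p ∧ x < f x ∧ (f * descendingProduct n d (p + 1)) x = f x) := by
  rcases mul_descendingProduct_apply hpd hd hfix x with h | ⟨y, h1, h2, h3, h4⟩ | ⟨h1, h2⟩
  · exact .inl h
  · rw [h4] at hx
    have := hexc y (by omega)
    omega
  · rw [h2] at hx
    exact .inr ⟨hexc x hx, hx, h2⟩

/-- Traces a nonexcedance back to its position `y` before the move. The passage from `x` to `y` is
strictly monotone because position `p` is skipped. -/
theorem nonexc_mul_descendingProduct (hpd : p < d) (hd : d < n)
    (hfix : ∀ x : Fin n, d ≤ x → f x = x)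
    (hexc : ∀ x : Fin n, x < f x → (x : ℕ) + 1 < p) {x : Fin n}
    (hx : (f * descendingProduct n d (p + 1)) x ≤ x) :
    ∃ y : Fin n, f y ≤ y ∧ (f * descendingProduct n d (p + 1)) x = f y ∧
      (((x : ℕ) < p ∨ d < x) ∧ y = x ∨ p < (x : ℕ) ∧ (x : ℕ) ≤ d ∧ (y : ℕ) + 1 = x) := by
  rcases mul_descendingProduct_apply hpd hd hfix x with h | ⟨y, h1, h2, h3, h4⟩ | ⟨h1, h2⟩
  · omega
  · refine ⟨y, ?_, h4, by omega⟩
    by_contra! h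
    have := hexc y h
    omega
  · exact ⟨x, h2 ▸ hx, h2, .inl ⟨h1, rfl⟩⟩

theorem IsTwoIncreasing.mul_descendingProduct (hf : IsTwoIncreasing f) (hpd : p < d) (hd : d < n)
    (hfix : ∀ x : Fin n, d ≤ x → f x = x)
    (hexc : ∀ x : Fin n, x < f x → (x : ℕ) + 1 < p) :
    IsTwoIncreasing (f * descendingProduct n d (p + 1)) where
  exc x y hxy hx hy := by
    rcases exc_mul_descendingProduct hpd hd hfix hexc hx with ⟨h1, h2⟩ | ⟨h1, h2, h3⟩ <;>
      rcases exc_mul_descendingProduct hpd hd hfix hexc hy with ⟨k1, k2⟩ | ⟨k1, k2, k3⟩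
    · omega
    · omega
    · have := apply_lt_of_fixes_tail hfix (x := x) (by omega)
      rw [h3]
      exact ⟨by omega, by omega⟩
    · rw [h3, k3]
      exact hf.exc x y hxy h2 k2
  nonexc x y hxy hx hy := by
    obtain ⟨x', h1, h2, h3⟩ := nonexc_mul_descendingProduct hpd hd hfix hexc hx
    obtain ⟨y', k1, k2, k3⟩ := nonexc_mul_descendingProduct hpd hd hfix hexc hy
    rw [h2, k2]
    refine hf.nonexc x' y' ?_ h1 k1
    simp only [Fin.ext_iff] at h3 k3
    omega

/-- Only position `p` changes its truncated excess, from `0` to `d - p`: entries shifted right were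
nonexcedances and remain so. -/
theorem sum_mul_descendingProduct (hpd : p < d) (hd : d < n)
    (hfix : ∀ x : Fin n, d ≤ x → f x = x)
    (hexc : ∀ x : Fin n, x < f x → (x : ℕ) + 1 < p) :
    ∑ x, (((f * descendingProduct n d (p + 1)) x : ℕ) - x) = ∑ x, ((f x : ℕ) - x) + (d - p) := by
  have h : ∀ x : Fin n, ((f * descendingProduct n d (p + 1)) x : ℕ) - x =
      ((f x : ℕ) - x) + if x = ⟨p, by omega⟩ then d - p else 0 := by
    intro x
    have hx := hexc x
    simp only [Fin.ext_iff, Fin.lt_def] at hx ⊢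
    rcases mul_descendingProduct_apply hpd hd hfix x with ⟨h1, h2⟩ | ⟨y, h1, h2, h3, h4⟩ | ⟨h1, h2⟩
    · rw [h2, if_pos h1]
      omega
    · have hy := hexc y
      rw [Fin.lt_def] at hy
      rw [h4, if_neg (by omega)]
      omega
    · rw [h2, if_neg (by omega), add_zero]
  simp only [h, Finset.sum_add_distrib, Finset.sum_ite_eq', Finset.mem_univ, if_true]

end MoveLeft

/-! ### Heights along a path -/

theorem height_zero (P : List Step) : height P 0 = 0 := by simp [height]

theorem height_succ (P : List Step) (i : ℕ) :
    height P (i + 1) = height P i + P[i]?.elim 0 Step.rise := by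
  rw [height, height, List.take_add_one, List.map_append, List.sum_append]
  cases P[i]? <;> simp

theorem height_succ_U {P : List Step} {i : ℕ} (h : P[i]? = some Step.U) :
    height P (i + 1) = height P i + 1 := by rw [height_succ, h]; rfl

theorem height_succ_D {P : List Step} {i : ℕ} (h : P[i]? = some Step.D) :
    height P (i + 1) = height P i - 1 := by rw [height_succ, h]; rfl

theorem height_succ_of_ne {P : List Step} {i : ℕ} (hU : P[i]? ≠ some Step.U)
    (hD : P[i]? ≠ some Step.D) : height P (i + 1) = height P i := by
  rw [height_succ]
  rcases h : P[i]? with _ | _ | _ | _ <;> simp_all [Step.rise]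

theorem height_succ_le {P : List Step} {i : ℕ} (hU : P[i]? ≠ some Step.U) :
    height P (i + 1) ≤ height P i := by
  by_cases hD : P[i]? = some Step.D
  · rw [height_succ_D hD]
    omega
  · exact (height_succ_of_ne hU hD).le

theorem height_sub_one_le (P : List Step) (i : ℕ) : height P i - 1 ≤ height P (i + 1) := by
  by_cases hU : P[i]? = some Step.U
  · rw [height_succ_U hU]
    omega
  · by_cases hD : P[i]? = some Step.D
    · rw [height_succ_D hD]
    · rw [height_succ_of_ne hU hD]
      omega

theorem height_sub_le (P : List Step) {i j : ℕ} (hij : i ≤ j) :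
    height P i - (j - i) ≤ height P j := by
  induction j, hij using Nat.le_induction with
  | base => simp
  | succ j _ ih =>
    have := height_sub_one_le P j
    push_cast
    omega

theorem height_le_of_no_U {P : List Step} {i j : ℕ} (hij : i ≤ j)
    (hU : ∀ k, i ≤ k → P[k]? ≠ some Step.U) : height P j ≤ height P i := by
  induction j, hij using Nat.le_induction with
  | base => rfl
  | succ j hj ih => exact (height_succ_le (hU j hj)).trans ih

theorem height_eq_of_no_D {P : List Step} {i j : ℕ} (hij : i ≤ j)
    (hU : ∀ k, i ≤ k → P[k]? ≠ some Step.U) (hD : ∀ k, i ≤ k → P[k]? ≠ some Step.D) :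
    height P j = height P i := by
  induction j, hij using Nat.le_induction with
  | base => rfl
  | succ j hj ih => exact (height_succ_of_ne (hU j hj) (hD j hj)).trans ih

/-! ### The last step of a kind -/

theorem getElem?_lastIndex {s : Step} {P : List Step} (h : s ∈ P) :
    P[lastIndex s P]? = some s := by
  obtain ⟨i, hi, rfl⟩ := List.getElem_of_mem h
  exact Nat.findGreatest_spec (P := fun j => P[j]? = some P[i]) hi.le
    (List.getElem?_eq_getElem hi)

theorem getElem?_ne_of_lastIndex_lt {s : Step} {P : List Step} {i : ℕ} (h : lastIndex s P < i) :
    P[i]? ≠ some s := by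
  intro hi
  exact Nat.findGreatest_is_greatest (P := fun j => P[j]? = some s) h
    (List.getElem?_eq_some_iff.1 hi).1.le hi

/-- The facts about the last up step `a` and the last down step `e` of a Motzkin path `P` of
length `n` that govern the removal of a strip. -/
structure IsStrip (n : ℕ) (P : List Step) (a e : ℕ) : Prop where
  up : P[a]? = some Step.U
  down : P[e]? = some Step.D
  lt : a < e
  lt_length : e < n
  no_up : ∀ i, a < i → P[i]? ≠ some Step.U
  no_down : ∀ i, e < i → P[i]? ≠ some Step.D

theorem IsMotzkinPath.no_down_of_no_up {n : ℕ} {P : List Step} (hP : IsMotzkinPath n P) {i : ℕ}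
    (hi : height P i = 0) (hU : ∀ k, i ≤ k → P[k]? ≠ some Step.U) :
    ∀ k, i ≤ k → P[k]? ≠ some Step.D := by
  intro k hk hD
  have h1 := height_le_of_no_U hk hU
  have h2 := height_succ_D hD
  have h3 := (List.getElem?_eq_some_iff.1 hD).1
  have h4 := hP.nonneg (k + 1) (by rw [← hP.length_eq]; omega)
  omega

theorem IsMotzkinPath.isStrip {n : ℕ} {P : List Step} (hP : IsMotzkinPath n P)
    (hU : Step.U ∈ P) : IsStrip n P (lastIndex Step.U P) (lastIndex Step.D P) := by
  have hlen := hP.length_eq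
  have ha := getElem?_lastIndex hU
  have hano : ∀ i, lastIndex Step.U P < i → P[i]? ≠ some Step.U :=
    fun i => getElem?_ne_of_lastIndex_lt
  set a := lastIndex Step.U P
  have han : a < P.length := (List.getElem?_eq_some_iff.1 ha).1
  have hsucc := height_succ_U ha
  have h0 := hP.nonneg a (by omega)
  -- After the last up step the height is positive, so a down step must follow to return to the
  -- axis.
  obtain ⟨k, hak, hk⟩ : ∃ k, a + 1 ≤ k ∧ P[k]? = some Step.D := by
    by_contra! h
    have h1 := height_eq_of_no_D (show a + 1 ≤ n by omega) (fun k hk => hano k hk) h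
    have h2 := hP.height_end
    omega
  have he := getElem?_lastIndex (List.mem_of_getElem? hk)
  have heno : ∀ i, lastIndex Step.D P < i → P[i]? ≠ some Step.D :=
    fun i => getElem?_ne_of_lastIndex_lt
  have hke : k ≤ lastIndex Step.D P := by
    by_contra! h
    exact heno k h hk
  have hen := (List.getElem?_eq_some_iff.1 he).1
  exact ⟨ha, he, by omega, by omega, hano, heno⟩

namespace IsStrip

variable {n a e : ℕ} {P : List Step}

theorem height_eq_zero (hP : IsMotzkinPath n P) (h : IsStrip n P a e) {i : ℕ} (hi : e < i) :
    height P i = 0 := by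
  have hlt := h.lt
  have h1 : ∀ j, e < j → height P j = height P (e + 1) := fun j hj =>
    height_eq_of_no_D hj (fun k hk => h.no_up k (by omega)) (fun k hk => h.no_down k hk)
  rw [h1 i hi, ← h1 n h.lt_length, hP.height_end]

theorem height_down (hP : IsMotzkinPath n P) (h : IsStrip n P a e) : height P e = 1 := by
  have h1 := height_succ_D h.down
  rw [h.height_eq_zero hP (Nat.lt_succ_self e)] at h1
  omega

theorem one_le_height (hP : IsMotzkinPath n P) (h : IsStrip n P a e) {i : ℕ} (hai : a < i)
    (hie : i ≤ e) : 1 ≤ height P i :=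
  (h.height_down hP).ge.trans (height_le_of_no_U hie fun k hk => h.no_up k (by omega))

/-- Every step after the last down step is already horizontal, so removing the strip only flattens
two steps. -/
theorem removeStrip_eq (h : IsStrip n P (lastIndex Step.U P) (lastIndex Step.D P)) :
    removeStrip P = (P.set (lastIndex Step.U P) Step.H).set (lastIndex Step.D P) Step.H := by
  have hlen := (List.getElem?_eq_some_iff.1 h.down).1
  have hlt := h.lt
  have hU := h.no_up
  have hD := h.no_down
  simp only [removeStrip]
  generalize lastIndex Step.U P = a at *
  generalize lastIndex Step.D P = e at *
  have htail : ∀ i, e < i → i < P.length → P[i]? = some Step.H := by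
    intro i hi hin
    have h1 := hU i (by omega)
    have h2 := hD i hi
    rw [List.getElem?_eq_getElem hin] at h1 h2 ⊢
    rcases h3 : P[i] <;> simp_all
  apply List.ext_getElem?
  intro i
  simp only [List.getElem?_append, List.getElem?_set, List.length_append, List.length_take,
    List.length_drop, List.length_set, List.length_singleton, List.getElem?_take,
    List.getElem?_drop, List.getElem?_replicate]
  have := htail i
  rcases lt_trichotomy i a with h1 | rfl | h1
  · grind
  · grind
  · rcases lt_trichotomy i e with h2 | rfl | h2
    · grind
    · grind
    · by_cases h3 : i < P.length <;> grind

theorem getElem?_removeStrip (h : IsStrip n P (lastIndex Step.U P) (lastIndex Step.D P)) (i : ℕ) :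
    (removeStrip P)[i]? =
      if i = lastIndex Step.U P ∨ i = lastIndex Step.D P then some Step.H else P[i]? := by
  have h1 := (List.getElem?_eq_some_iff.1 h.down).1
  have h2 := (List.getElem?_eq_some_iff.1 h.up).1
  rw [h.removeStrip_eq]
  simp only [List.getElem?_set, List.length_set]
  grind

theorem count_removeStrip (h : IsStrip n P (lastIndex Step.U P) (lastIndex Step.D P)) :
    (removeStrip P).count Step.U + 1 = P.count Step.U := by
  have h1 := List.getElem?_eq_some_iff.1 h.down
  have h2 := List.getElem?_eq_some_iff.1 h.up
  have h3 : 0 < P.count Step.U := List.count_pos_iff.2 (List.mem_of_getElem? h.up)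
  obtain ⟨h1, h1'⟩ := h1
  obtain ⟨h2, h2'⟩ := h2
  rw [h.removeStrip_eq, List.count_set (by simpa using h1), List.count_set h2]
  rw [List.getElem_set_ne h.lt.ne, h1', h2']
  simp
  omega

theorem height_removeStrip (h : IsStrip n P (lastIndex Step.U P) (lastIndex Step.D P)) (i : ℕ) :
    height (removeStrip P) i =
      height P i - if lastIndex Step.U P < i ∧ i ≤ lastIndex Step.D P then 1 else 0 := by
  have hlt := h.lt
  induction i with
  | zero => simp [height_zero]
  | succ i ih =>
    rw [height_succ, ih]
    by_cases h1 : i = lastIndex Step.U P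
    · rw [h.getElem?_removeStrip, if_pos (Or.inl h1), height_succ_U (h1 ▸ h.up)]
      simp only [Option.elim_some, Step.rise]
      split_ifs <;> omega
    · by_cases h2 : i = lastIndex Step.D P
      · rw [h.getElem?_removeStrip, if_pos (Or.inr h2), height_succ_D (h2 ▸ h.down)]
        simp only [Option.elim_some, Step.rise]
        split_ifs <;> omega
      · rw [h.getElem?_removeStrip, if_neg (not_or.2 ⟨h1, h2⟩), height_succ P]
        split_ifs <;> omega

end IsStrip

theorem IsMotzkinPath.removeStrip {n : ℕ} {P : List Step} (hP : IsMotzkinPath n P)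
    (hU : Step.U ∈ P) : IsMotzkinPath n (removeStrip P) where
  length_eq := by
    rw [(hP.isStrip hU).removeStrip_eq, List.length_set, List.length_set, hP.length_eq]
  nonneg i hi := by
    have h := hP.isStrip hU
    rw [h.height_removeStrip]
    split_ifs with h1
    · have := h.one_le_height hP h1.1 h1.2
      omega
    · simpa using hP.nonneg i hi
  height_end := by
    have h := hP.isStrip hU
    have := h.lt_length
    rw [h.height_removeStrip, if_neg (by omega), hP.height_end, sub_zero]

/-! ### The recursion for `φ` -/

theorem phi_eq_one (n : ℕ) {P : List Step} (hU : Step.U ∉ P) : phi n P = 1 := by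
  simp [phi, stripParameters, List.count_eq_zero_of_not_mem hU]

/-- The strip of `P` itself is the last factor. Its head is `e + 1 - 1` since the last down step
starts at height `1`; its tail is `(a + 1) + (height P a + 1) - 1`. -/
theorem phi_eq_mul {n : ℕ} {P : List Step} (hP : IsMotzkinPath n P) (hU : Step.U ∈ P) :
    phi n P = phi n (removeStrip P) * descendingProduct n (lastIndex Step.D P)
      ((lastIndex Step.U P + height P (lastIndex Step.U P)).toNat + 1) := by
  have h := hP.isStrip hU
  have hc := h.count_removeStrip
  have hlt := h.lt
  have h0 := hP.nonneg (lastIndex Step.U P) (by have := h.lt_length; omega)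
  have hhead : stripHead P = lastIndex Step.D P := by
    rw [stripHead, stepLabel, cellLabel, h.height_down hP]
    omega
  have htail : stripTail P =
      (lastIndex Step.U P + height P (lastIndex Step.U P)).toNat + 1 := by
    rw [stripTail, stepLabel, cellLabel, height_succ_U h.up]
    omega
  have hpar : stripParameters P =
      stripParameters (removeStrip P) ++ [(stripHead P, stripTail P)] := by
    simp only [stripParameters, ← hc, List.range_succ, List.map_append, List.map_cons,
      List.map_nil, Nat.sub_self, Function.iterate_zero, id_eq]
    congr 1
    refine List.map_congr_left fun i hi => ?_
    rw [List.mem_range] at hi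
    rw [show (removeStrip P).count Step.U + 1 - (i + 1) =
      (removeStrip P).count Step.U - (i + 1) + 1 by omega, Function.iterate_succ_apply]
  rw [phi, hpar, List.map_append, List.prod_append, List.map_singleton, List.prod_singleton,
    hhead, htail, phi]

/-! ### The area -/

theorem graph_of_mem_Ico (P : List Step) {i : ℕ} {x : ℝ} (h1 : (i : ℝ) ≤ x) (h2 : x < i + 1) :
    graph P x = height P i + (x - i) * (height P (i + 1) - height P i) := by
  rw [graph, (Nat.floor_eq_iff (i.cast_nonneg.trans h1)).2 ⟨h1, h2⟩]

theorem measurable_graph (P : List Step) : Measurable (graph P) := by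
  have h1 : Measurable fun x : ℝ => (height P ⌊x⌋₊ : ℝ) :=
    (measurable_from_top (f := fun k : ℕ => (height P k : ℝ))).comp Nat.measurable_floor
  have h2 : Measurable fun x : ℝ => (height P (⌊x⌋₊ + 1) : ℝ) :=
    (measurable_from_top (f := fun k : ℕ => (height P (k + 1) : ℝ))).comp Nat.measurable_floor
  have h3 : Measurable fun x : ℝ => (⌊x⌋₊ : ℝ) :=
    (measurable_from_top (f := fun k : ℕ => (k : ℝ))).comp Nat.measurable_floor
  exact h1.add ((measurable_id.sub h3).mul (h2.sub h1))

open MeasureTheory in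
theorem intervalIntegral_graph (P : List Step) (i : ℕ) :
    IntervalIntegrable (graph P) volume i ((i + 1 : ℕ) : ℝ) ∧
      ∫ x in (i : ℝ)..((i + 1 : ℕ) : ℝ), graph P x = (height P i + height P (i + 1)) / 2 := by
  have hle : (i : ℝ) ≤ ((i + 1 : ℕ) : ℝ) := by push_cast; linarith
  have heq : Set.EqOn
      (fun x : ℝ => (height P i : ℝ) + (x - i) * (height P (i + 1) - height P i))
      (graph P) (Set.Ioo (i : ℝ) ((i + 1 : ℕ) : ℝ)) := fun x hx => by
    have := hx.2
    push_cast at this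
    exact (graph_of_mem_Ico P hx.1.le this).symm
  constructor
  · have hc : IntervalIntegrable
        (fun x : ℝ => (height P i : ℝ) + (x - i) * (height P (i + 1) - height P i))
        volume i ((i + 1 : ℕ) : ℝ) := Continuous.intervalIntegrable (by fun_prop) _ _
    rw [intervalIntegrable_iff_integrableOn_Ioo_of_le hle] at hc ⊢
    exact hc.congr_fun heq measurableSet_Ioo
  · rw [intervalIntegral.integral_of_le hle, integral_Ioc_eq_integral_Ioo,
      ← setIntegral_congr_fun measurableSet_Ioo heq, ← integral_Ioc_eq_integral_Ioo,
      ← intervalIntegral.integral_of_le hle, intervalIntegral.integral_add (by simp)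
        (Continuous.intervalIntegrable (by fun_prop) _ _), intervalIntegral.integral_mul_const,
      intervalIntegral.integral_sub (by simp) (by simp), integral_id]
    simp only [intervalIntegral.integral_const, smul_eq_mul]
    push_cast
    ring

theorem graph_nonneg {n : ℕ} {P : List Step} (hP : IsMotzkinPath n P) {x : ℝ} (h0 : 0 ≤ x)
    (h1 : x < n) : 0 ≤ graph P x := by
  have hfl := Nat.floor_le h0
  have hlt := Nat.lt_floor_add_one x
  have hn : ⌊x⌋₊ < n := (Nat.floor_lt h0).2 h1
  have ha : (0 : ℝ) ≤ height P ⌊x⌋₊ := by exact_mod_cast hP.nonneg _ hn.le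
  have hb : (0 : ℝ) ≤ height P (⌊x⌋₊ + 1) := by exact_mod_cast hP.nonneg _ hn
  rw [graph]
  nlinarith [mul_nonneg (sub_nonneg.2 hfl) hb, mul_nonneg (sub_nonneg.2 hlt.le) ha]

-- Integrating over vertical fibres gives a sum of trapezoids `(height P i + height P (i + 1)) / 2`.
-- It telescopes to the sum of heights because both endpoints lie on the axis.
open MeasureTheory in
theorem area_eq_sum_height {n : ℕ} {P : List Step} (hP : IsMotzkinPath n P) :
    area P = ((∑ i ∈ Finset.range n, height P i : ℤ) : ℝ) := by
  have hint : IntegrableOn (graph P) (Set.Ioo 0 (n : ℝ)) := by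
    rw [← intervalIntegrable_iff_integrableOn_Ioo_of_le n.cast_nonneg]
    simpa using IntervalIntegrable.trans_iterate (a := fun k : ℕ => (k : ℝ)) (n := n)
      fun k _ => (intervalIntegral_graph P k).1
  have hfib : ∀ x : ℝ, volume (Prod.mk x ⁻¹' region P) =
      (Set.Icc 0 (n : ℝ)).indicator (fun x => ENNReal.ofReal (graph P x)) x := by
    intro x
    by_cases hx : x ∈ Set.Icc 0 (n : ℝ)
    · have : Prod.mk x ⁻¹' region P = Set.Icc 0 (graph P x) := by
        ext y
        simp [region, hP.length_eq, hx.1, hx.2]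
      rw [this, Set.indicator_of_mem hx, Real.volume_Icc, sub_zero]
    · have : Prod.mk x ⁻¹' region P = ∅ := by
        ext y
        simp only [region, hP.length_eq, Set.mem_preimage, Set.mem_ofPred_eq, Set.mem_empty_iff_false,
          iff_false]
        exact fun h => hx ⟨h.1, h.2.1⟩
      rw [this, Set.indicator_of_notMem hx, measure_empty]
  have hmeas : MeasurableSet (region P) := by
    have h2 : Measurable fun p : ℝ × ℝ => graph P p.1 := (measurable_graph P).comp measurable_fst
    exact (measurableSet_le measurable_const measurable_fst).inter
      ((measurableSet_le measurable_fst measurable_const).inter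
      ((measurableSet_le measurable_const measurable_snd).inter
        (measurableSet_le measurable_snd h2)))
  have hnn : 0 ≤ᵐ[volume.restrict (Set.Ioo 0 (n : ℝ))] graph P :=
    (ae_restrict_iff' measurableSet_Ioo).2
      (Filter.Eventually.of_forall fun x hx => graph_nonneg hP hx.1.le hx.2)
  have hsum : ∫ x in Set.Ioo 0 (n : ℝ), graph P x =
      ∑ i ∈ Finset.range n, ((height P i : ℝ) + height P (i + 1)) / 2 := by
    rw [← integral_Ioc_eq_integral_Ioo, ← intervalIntegral.integral_of_le n.cast_nonneg]
    have h := intervalIntegral.sum_integral_adjacent_intervals (μ := volume)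
      (a := fun k : ℕ => (k : ℝ)) (n := n) fun k _ => (intervalIntegral_graph P k).1
    rw [Nat.cast_zero] at h
    rw [← h]
    exact Finset.sum_congr rfl fun i _ => (intervalIntegral_graph P i).2
  have htel : ∑ i ∈ Finset.range n, (height P (i + 1) : ℝ) =
      ∑ i ∈ Finset.range n, (height P i : ℝ) := by
    have h := Finset.sum_range_sub (fun i => (height P i : ℝ)) n
    have h0 : height P 0 = 0 := by simp [height]
    rw [Finset.sum_sub_distrib, hP.height_end, h0] at h
    linarith
  rw [area, Measure.volume_eq_prod, Measure.prod_apply hmeas, lintegral_congr hfib,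
    lintegral_indicator measurableSet_Icc, setLIntegral_congr Ioo_ae_eq_Icc.symm,
    ← ofReal_integral_eq_lintegral_ofReal hint hnn,
    ENNReal.toReal_ofReal (integral_nonneg_of_ae hnn), hsum, ← Finset.sum_div,
    Finset.sum_add_distrib, htel]
  push_cast
  ring

/-! ### The permutation of a Motzkin path -/

theorem upHeightSum_eq {n : ℕ} {P : List Step} (hn : P.length = n) :
    upHeightSum P = ∑ i ∈ Finset.range n, if P[i]? = some Step.U then height P i else 0 := by
  rw [upHeightSum, Finset.sum_filter, hn]

/-- Heights drop by one exactly for `a < i ≤ e`. No up step lies there, so the other up steps keep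
their heights and only the one at `a` is lost. -/
theorem sum_height_sub_upHeightSum {n : ℕ} {P : List Step} (hP : IsMotzkinPath n P)
    (hU : Step.U ∈ P) :
    ∑ i ∈ Finset.range n, height P i - upHeightSum P =
      (∑ i ∈ Finset.range n, height (removeStrip P) i - upHeightSum (removeStrip P)) +
        (lastIndex Step.D P - (lastIndex Step.U P + height P (lastIndex Step.U P))) := by
  have h := hP.isStrip hU
  have hlt := h.lt
  have hen := h.lt_length
  have h1 : ∑ i ∈ Finset.range n, height P i = ∑ i ∈ Finset.range n, height (removeStrip P) i +
      (lastIndex Step.D P - lastIndex Step.U P) := by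
    simp only [h.height_removeStrip, Finset.sum_sub_distrib]
    rw [← Finset.sum_filter, Finset.sum_const]
    have : (Finset.range n).filter
        (fun i => lastIndex Step.U P < i ∧ i ≤ lastIndex Step.D P) =
        Finset.Ioc (lastIndex Step.U P) (lastIndex Step.D P) := by
      ext i
      simp only [Finset.mem_filter, Finset.mem_range, Finset.mem_Ioc]
      omega
    rw [this, Nat.card_Ioc, nsmul_eq_mul, mul_one, Nat.cast_sub hlt.le]
    ring
  have h2 : upHeightSum P = upHeightSum (removeStrip P) + height P (lastIndex Step.U P) := by
    rw [upHeightSum_eq hP.length_eq, upHeightSum_eq (hP.removeStrip hU).length_eq]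
    have h3 : ∀ i, (if P[i]? = some Step.U then height P i else 0) =
        (if (removeStrip P)[i]? = some Step.U then height (removeStrip P) i else 0) +
          if i = lastIndex Step.U P then height P (lastIndex Step.U P) else 0 := by
      intro i
      rw [h.getElem?_removeStrip, h.height_removeStrip]
      by_cases hia : i = lastIndex Step.U P
      · rw [hia, if_pos h.up, if_pos (Or.inl rfl), if_neg (by simp), if_pos rfl, zero_add]
      · by_cases hie : i = lastIndex Step.D P
        · rw [hie, h.down, if_neg (by simp), if_pos (Or.inr rfl), if_neg (by simp),
            if_neg (by omega), zero_add]
        · rw [if_neg (not_or.2 ⟨hia, hie⟩), if_neg hia, add_zero]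
          by_cases hiU : P[i]? = some Step.U
          · have : ¬ lastIndex Step.U P < i := fun hlt => h.no_up i hlt hiU
            rw [if_pos hiU, if_pos hiU, if_neg (by omega), sub_zero]
          · rw [if_neg hiU, if_neg hiU]
    simp only [h3, Finset.sum_add_distrib, Finset.sum_ite_eq', Finset.mem_range]
    rw [if_pos (by omega)]
  rw [h1, h2]
  ring

/-- The properties of the permutation `φ(P)` of a Motzkin path `P` that can be followed through the
strip decomposition. -/
structure IsPathPerm (n : ℕ) (P : List Step) (f : Equiv.Perm (Fin n)) : Prop where
  twoIncreasing : IsTwoIncreasing f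
  exc : ∀ x : Fin n, x < f x → ∃ u : ℕ, P[u]? = some Step.U ∧ ((x : ℕ) : ℤ) = u + height P u
  fixed_of_tail : ∀ x : Fin n, (∀ j : ℕ, x ≤ j → P[j]? ≠ some Step.D) → f x = x
  flat_of_fixed : ∀ x : Fin n, f x = x → P[(x : ℕ)]? = some Step.H ∧ height P x = 0
  sum_eq : ((∑ x, ((f x : ℕ) - x) : ℕ) : ℤ) =
    ∑ i ∈ Finset.range n, height P i - upHeightSum P

theorem isPathPerm_one {n : ℕ} {P : List Step} (hP : IsMotzkinPath n P) (hU : Step.U ∉ P) :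
    IsPathPerm n P 1 := by
  have hU' : ∀ i, P[i]? ≠ some Step.U := fun i h => hU (List.mem_of_getElem? h)
  have hD : ∀ i, P[i]? ≠ some Step.D := fun i =>
    hP.no_down_of_no_up (height_zero P) (fun k _ => hU' k) i (Nat.zero_le i)
  have h0 : ∀ i, height P i = 0 := fun i =>
    (height_eq_of_no_D (Nat.zero_le i) (fun k _ => hU' k) fun k _ => hD k).trans (height_zero P)
  refine ⟨⟨fun x y _ h => absurd h (lt_irrefl _), fun x y h _ _ => h⟩,
    fun x h => absurd h (lt_irrefl _), fun _ _ => rfl, fun x _ => ⟨?_, h0 x⟩, ?_⟩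
  · have h1 := hU' x
    have h2 := hD x
    have hx : (x : ℕ) < P.length := hP.length_eq.symm ▸ x.2
    rw [List.getElem?_eq_getElem hx] at h1 h2 ⊢
    rcases h3 : P[(x : ℕ)] <;> simp_all
  · simp [upHeightSum, h0]

theorem IsPathPerm.mul_descendingProduct {n : ℕ} {P : List Step} (hP : IsMotzkinPath n P)
    (hU : Step.U ∈ P) {f : Equiv.Perm (Fin n)} (hf : IsPathPerm n (removeStrip P) f) :
    IsPathPerm n P (f * descendingProduct n (lastIndex Step.D P)
      ((lastIndex Step.U P + height P (lastIndex Step.U P)).toNat + 1)) := by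
  have h := hP.isStrip hU
  have hsum := sum_height_sub_upHeightSum hP hU
  have hgetQ := h.getElem?_removeStrip
  have hhtQ := h.height_removeStrip
  have hlt := h.lt
  have hen := h.lt_length
  have hdown := h.height_down hP
  have hup := height_succ_U h.up
  have ha0 := hP.nonneg (lastIndex Step.U P) (by omega)
  have hnoU := h.no_up
  have hnoD := h.no_down
  have heD := h.down
  have haU := h.up
  generalize removeStrip P = Q at *
  generalize lastIndex Step.D P = e at *
  generalize lastIndex Step.U P = a at *
  obtain ⟨p, hp⟩ : ∃ p : ℕ, (p : ℤ) = a + height P a := ⟨_, Int.toNat_of_nonneg (by omega)⟩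
  rw [← hp, Int.toNat_natCast]
  -- The path falls from `height P a + 1` at `a + 1` to `1` at `e`, which takes at least `height P
  -- a` steps.
  have hpe : p < e := by
    have := height_sub_le P (show a + 1 ≤ e by omega)
    push_cast at this
    omega
  have hfix : ∀ x : Fin n, e ≤ x → f x = x := fun x hx => hf.fixed_of_tail x fun j hj => by
    rw [hgetQ]
    split_ifs with hj'
    · simp
    · exact hnoD j (by omega)
  have hexcQ : ∀ x : Fin n, x < f x →
      ∃ u : ℕ, u < a ∧ P[u]? = some Step.U ∧ ((x : ℕ) : ℤ) = u + height P u := by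
    intro x hx
    obtain ⟨u, hu1, hu2⟩ := hf.exc x hx
    rw [hgetQ] at hu1
    split_ifs at hu1 with hu3
    · simp at hu1
    have hua : u < a := by
      by_contra! hau
      exact hnoU u (by omega) hu1
    rw [hhtQ, if_neg (by omega), sub_zero] at hu2
    exact ⟨u, hua, hu1, hu2⟩
  have hexc : ∀ x : Fin n, x < f x → (x : ℕ) + 1 < p := by
    intro x hx
    obtain ⟨u, hua, hu1, hu2⟩ := hexcQ x hx
    have h1 := height_succ_U hu1
    have h2 := height_sub_le P (show u + 1 ≤ a by omega)
    push_cast at h2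
    omega
  refine ⟨hf.twoIncreasing.mul_descendingProduct hpe hen hfix hexc, fun x hx => ?_,
    fun x hx => ?_, fun x hx => ?_, ?_⟩
  · rcases exc_mul_descendingProduct hpe hen hfix hexc hx with ⟨h1, -⟩ | ⟨-, h2, -⟩
    · exact ⟨a, haU, by omega⟩
    · obtain ⟨u, -, hu⟩ := hexcQ x h2
      exact ⟨u, hu⟩
  · have hex : e < (x : ℕ) := by
      by_contra! hxe
      exact hx e hxe heD
    rcases mul_descendingProduct_apply hpe hen hfix x with h1 | ⟨y, h1, h2, h3, -⟩ | ⟨-, h2⟩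
    · omega
    · omega
    · rw [h2, hfix x hex.le]
  · rcases mul_descendingProduct_apply hpe hen hfix x with ⟨h1, h2⟩ | ⟨y, h1, h2, h3, h4⟩ | ⟨h1, h2⟩
    · rw [hx] at h2
      omega
    · have h5 := hexc y
      rw [← h4, hx, Fin.lt_def] at h5
      omega
    · obtain ⟨h3, h4⟩ := hf.flat_of_fixed x (h2.symm.trans hx)
      have hQ := height_sub_le Q (i := a) (j := x)
      have hQa := hhtQ a
      rw [if_neg (by omega)] at hQa
      rw [hgetQ] at h3
      rw [hhtQ] at h4
      -- If `a ≤ x ≤ e`, then `x < p`, so `Q` would have to fall from `height P a` at `a` to `0` in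
      -- fewer than `height P a` steps. Outside this range `P` and `Q` agree.
      have hxa : (x : ℕ) < a ∨ e < (x : ℕ) := by
        by_contra! hxa
        have := hQ hxa.1
        rw [hhtQ x, h4] at this
        omega
      rw [if_neg (by omega)] at h3 h4
      exact ⟨h3, by simpa using h4⟩
  · rw [sum_mul_descendingProduct hpe hen hfix hexc, hsum, Nat.cast_add, hf.sum_eq,
      Nat.cast_sub hpe.le, hp]

theorem isPathPerm_phi {n : ℕ} {P : List Step} (hP : IsMotzkinPath n P) :
    IsPathPerm n P (phi n P) := by
  obtain ⟨k, hk⟩ : ∃ k, P.count Step.U = k := ⟨_, rfl⟩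
  induction k generalizing P with
  | zero =>
    have hU := List.count_eq_zero.1 hk
    rw [phi_eq_one n hU]
    exact isPathPerm_one hP hU
  | succ k ih =>
    have hU : Step.U ∈ P := List.count_pos_iff.1 (by omega)
    rw [phi_eq_mul hP hU]
    have := (hP.isStrip hU).count_removeStrip
    exact (ih (hP.removeStrip hU) (by omega)).mul_descendingProduct hP hU

end Riordan

theorem mainTheorem6 (n : ℕ) (P : List Riordan.Step) (hP : Riordan.IsRiordanPath n P) :
    Riordan.phi n P ∈ Riordan.avoidingDerangements n ∧
      Riordan.area P - (Riordan.upHeightSum P : ℝ) =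
        (Riordan.inversionNumber (Riordan.phi n P) : ℝ) := by
  have h := Riordan.isPathPerm_phi hP.toIsMotzkinPath
  refine ⟨⟨fun x hx => ?_, h.twoIncreasing.avoids321, h.twoIncreasing.avoids3142Bar⟩, ?_⟩
  · obtain ⟨h1, h2⟩ := h.flat_of_fixed x hx
    exact hP.no_flat x x.2 h1 h2
  · rw [Riordan.area_eq_sum_height hP.toIsMotzkinPath, h.twoIncreasing.inversionNumber_eq,
      ← Int.cast_sub, ← h.sum_eq, Int.cast_natCast]
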